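/- Let $(X,d)$ be a compact metric space with at least two points, $f:X\to X$ a continuous map and $\varphi:X\to\mathbb{R}$ a continuous function. For $\varepsilon>0$, $x,y\in X$ and integers $0\le a\le b$, say that $x$ $\varepsilon$-traces $y$ on $[a,b]$ if $d(f^i x,f^{i-a}y)<\varepsilon$ for all integers $i\in[a,b]$. Suppose that $(X,f)$ has the specification property: for every $\varepsilon>0$ there is a positive integer $K_\varepsilon$ such that for every integer $s\ge 2$, all points $y_1,\dots,y_s\in X$ and all integers $0=a_1\le b_1<a_2\le b_2<\cdots<a_s\le b_s$ with $a_{m+1}-b_m\ge K_\varepsilon$ for $m=1,\dots,s-1$, there is a point $x\in X$ that $\varepsilon$-traces $y_m$ on $[a_m,b_m]$ for every $1\le m\le s$. Suppose that the $\varphi$-irregular set $$I_\varphi(f)=\Bigl\{x\in X:\ \tfrac1n\sum_{i=0}^{n-1}\varphi(f^i x)\ \text{does not converge as } n\to\infty\Bigr\}$$ is nonempty. Then there is an uncountable set $S\subseteq I_\varphi(f)$ that is DC1-scrambled, that is, for any two distinct points $x,y\in S$, $$\forall t>0:\ \limsup_{n\to\infty}\frac1n\bigl|\{0\le i\le n-1:\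 d(f^i x,f^i y)<t\}\bigr|=1,$$ $$\exists t_0>0:\ \liminf_{n\to\infty}\frac1n\bigl|\{0\le i\le n-1:\ d(f^i x,f^i y)<t_0\}\bigr|=0.$$ -/

import Mathlib

open Filter Topology

/-- `x` `ε`-traces `y` on `[a, b]`: `d(f^i x, f^(i-a) y) < ε` for all integers `a ≤ i ≤ b`. -/
def EpsTraces {X : Type*} [MetricSpace X] (f : X → X) (ε : ℝ) (x y : X) (a b : ℕ) : Prop :=
  ∀ i : ℕ, a ≤ i → i ≤ b → dist (f^[i] x) (f^[i - a] y) < ε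

/-- The specification property (no periodicity of the tracing point is required). The points
`y 0, …, y (s - 1)` and the integers
`0 = a 0 ≤ b 0 < a 1 ≤ b 1 < ⋯ < a (s - 1) ≤ b (s - 1)` are given as the first `s` terms of
sequences; later terms play no role. -/
def HasSpecification {X : Type*} [MetricSpace X] (f : X → X) : Prop :=
  ∀ ε : ℝ, 0 < ε → ∃ K : ℕ, 0 < K ∧
    ∀ s : ℕ, 2 ≤ s → ∀ (y : ℕ → X) (a b : ℕ → ℕ),
      a 0 = 0 →
      (∀ m < s, a m ≤ b m) →
      (∀ m, m + 1 < s → b m < a (m + 1) ∧ b m + K ≤ a (m + 1)) →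
      ∃ x : X, ∀ m < s, EpsTraces f ε x (y m) (a m) (b m)

/-- The proportion of times `0 ≤ i ≤ n - 1` at which the orbits of `x` and `y` are at distance
less than `t`. -/
noncomputable def closeFrequency {X : Type*} [MetricSpace X] (f : X → X) (x y : X) (t : ℝ)
    (n : ℕ) : ℝ :=
  (((Finset.range n).filter fun i => dist (f^[i] x) (f^[i] y) < t).card : ℝ) / (n : ℝ)

/-- The pair `x, y` is DC1-scrambled (distributionally chaotic of type 1). -/
def IsDC1Pair {X : Type*} [MetricSpace X] (f : X → X) (x y : X) : Prop :=
  (∀ t : ℝ, 0 < t → limsup (fun n : ℕ => closeFrequency f x y t n) atTop = 1) ∧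
  (∃ t₀ : ℝ, 0 < t₀ ∧ liminf (fun n : ℕ => closeFrequency f x y t₀ n) atTop = 0)

/-- `S` is a DC1-scrambled set: any two distinct points of `S` form a DC1-scrambled pair. -/
def IsDC1ScrambledSet {X : Type*} [MetricSpace X] (f : X → X) (S : Set X) : Prop :=
  ∀ x ∈ S, ∀ y ∈ S, x ≠ y → IsDC1Pair f x y

/-- The `φ`-irregular set: the points whose Birkhoff averages
`(1/n) ∑_{i < n} φ (f^i x)` do not converge. -/
def irregularSet {X : Type*} (f : X → X) (φ : X → ℝ) : Set X :=
  {x | ¬ ∃ l : ℝ, Tendsto (fun n : ℕ => birkhoffAverage ℝ f φ n x) atTop (𝓝 l)}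

/-! Fix an irregular point `z` and a distal pair `u`, `v`. Specification, iterated along an infinite
sequence of blocks, gives for each bit sequence `ξ` a point `x ξ` whose orbit follows `z` on blocks
of index 0 and 1 mod 3, and `u` or `v`, according to a bit of `ξ`, on blocks of index 2 mod 3. Each
block is far longer than all the time before it, so it alone decides averages and frequencies at its
end.

The `z` blocks end where the averages of `z` lie below `α` or above `β` in turn, so `x ξ` is
irregular; there any two of these points are close, so the limsup is 1. Every bit recurs in
infinitely many blocks, and where two sequences differ the points are far apart, so the liminf is 0.
Block times do not depend on `ξ` (`exists_tracing_times`), which keeps the orbits synchronised. -/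

section Tracing

/-! ### Consequences of specification -/

variable {X : Type*} [MetricSpace X] [CompactSpace X] {f : X → X}

/-- A system with specification contains a point whose orbit comes close to `q` at all times in
an arithmetic progression. -/
theorem exists_syndetic_visits (hf : Continuous f) (hspec : HasSpecification f) (q : X)
    {ε : ℝ} (hε : 0 < ε) :
    ∃ x : X, ∃ K : ℕ, 0 < K ∧ ∀ j : ℕ, dist (f^[j * K] x) q ≤ ε := by
  obtain ⟨K, hK0, hK⟩ := hspec ε hε
  let A : ℕ → Set X := fun s => {x | ∀ j < s, dist (f^[j * K] x) q ≤ ε}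
  have hA : ∀ s, IsClosed (A s) := by
    intro s
    have : A s = ⋂ j : ℕ, ⋂ _ : j < s, {x | dist (f^[j * K] x) q ≤ ε} := by
      ext x; simp [A]
    rw [this]
    exact isClosed_iInter fun j => isClosed_iInter fun _ =>
      isClosed_le ((hf.iterate _).dist continuous_const) continuous_const
  obtain ⟨x, hx⟩ := IsCompact.nonempty_iInter_of_sequence_nonempty_isCompact_isClosed A
    (fun s x hx j hj => hx j (by omega))
    (by
      intro s
      -- Blocks of a single time; `s + 2` because specification needs at least two blocks.
      obtain ⟨x, hx⟩ := hK (s + 2) (by omega) (fun _ => q) (fun m => m * K) (fun m => m * K)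
        (by simp) (fun m _ => le_rfl) (fun m _ => ⟨by nlinarith, by ring_nf; omega⟩)
      refine ⟨x, fun j hj => ?_⟩
      have := hx j (by omega) (j * K) le_rfl le_rfl
      simpa using this.le)
    (hA 0).isCompact hA
  refine ⟨x, K, hK0, fun j => ?_⟩
  exact Set.mem_iInter.1 hx (j + 1) j (by omega)

/-- A nontrivial system with specification has a distal pair. -/
theorem exists_distal_pair [Nontrivial X] (hf : Continuous f) (hspec : HasSpecification f) :
    ∃ u v : X, ∃ c : ℝ, 0 < c ∧ ∀ i : ℕ, c ≤ dist (f^[i] u) (f^[i] v) := by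
  by_cases hfix : ∃ p, f p = p
  · obtain ⟨p, hp⟩ := hfix
    obtain ⟨q, hq⟩ := exists_ne p
    have hpq : 0 < dist q p := dist_pos.2 hq
    obtain ⟨x, K, hK0, hx⟩ := exists_syndetic_visits hf hspec q (half_pos (half_pos hpq))
    have hpi : ∀ i, f^[i] p = p := fun i => Function.iterate_fixed hp i
    have hnear : ∀ j, ∀ᶠ y in 𝓝 p, dist (f^[j] y) p < dist q p / 2 := by
      intro j
      have h := ((hf.iterate j).tendsto p).eventually
        (Metric.ball_mem_nhds (f^[j] p) (half_pos hpq))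
      simpa [hpi j] using h
    -- An orbit entering a small ball around `p` stays near `p` for `K` steps, hence misses the next
    -- visit to `q`.
    have hall : ∀ᶠ y in 𝓝 p, ∀ j ∈ Finset.range (K + 1), dist (f^[j] y) p < dist q p / 2 :=
      (Filter.eventually_all_finset _).2 fun j _ => hnear j
    obtain ⟨c, hc, hball⟩ := Metric.eventually_nhds_iff.1 hall
    refine ⟨x, p, c, hc, fun i => ?_⟩
    rw [hpi]
    by_contra! hlt
    have hmod := Nat.mod_lt i hK0
    have hdiv := Nat.div_add_mod i K
    have h1 := hball hlt (K - i % K) (Finset.mem_range.2 (by omega))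
    rw [← Function.iterate_add_apply] at h1
    have hi : K - i % K + i = (i / K + 1) * K := by
      have : (i / K + 1) * K = K * (i / K) + K := by ring
      omega
    rw [hi] at h1
    have h2 := hx (i / K + 1)
    have h3 := dist_triangle_left q p (f^[(i / K + 1) * K] x)
    linarith
  · push Not at hfix
    obtain ⟨w⟩ : Nonempty X := inferInstance
    obtain ⟨m, -, hm⟩ := isCompact_univ.exists_isMinOn (Set.univ_nonempty (α := X))
      (continuous_id.dist hf).continuousOn
    -- Without fixed points, the displacement has a positive minimum, so consecutive points of an
    -- orbit stay apart.
    refine ⟨w, f w, dist m (f m), dist_pos.2 (hfix m).symm, fun i => ?_⟩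
    rw [← Function.iterate_succ_apply, Function.iterate_succ_apply']
    exact hm (Set.mem_univ (f^[i] w))

/-- Infinite specification: blocks of prescribed lengths, which may depend on their starting
times, can be traced with geometrically decreasing errors, at times that do not depend on the
traced points. -/
theorem exists_tracing_times (hf : Continuous f) (hspec : HasSpecification f)
    (L : ℕ → ℕ → ℕ) :
    ∃ a : ℕ → ℕ, ∀ y : ℕ → X, ∃ x : X, ∀ n, ∀ i ≤ L n (a n),
      dist (f^[a n + i] x) (f^[i] (y n)) ≤ 4 * (1 / 2 : ℝ) ^ n := by
  choose K hK0 hK using fun n : ℕ => hspec ((1 / 2 : ℝ) ^ n) (by positivity)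
  let a : ℕ → ℕ := fun n => Nat.rec 0 (fun n m => m + L n m + K n) n
  have ha : ∀ n, a (n + 1) = a n + L n (a n) + K n := fun _ => rfl
  refine ⟨a, fun y => ?_⟩
  -- Two-block specification: keep the past of `w` up to the end of block `n` and append block `n +
  -- 1`. The errors are summable, so the successive points converge.
  have step : ∀ (n : ℕ) (w : X), ∃ x : X,
      (∀ i ≤ a n + L n (a n), dist (f^[i] x) (f^[i] w) < (1 / 2 : ℝ) ^ n) ∧
      ∀ i ≤ L (n + 1) (a (n + 1)),
        dist (f^[a (n + 1) + i] x) (f^[i] (y (n + 1))) < (1 / 2 : ℝ) ^ n := by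
    intro n w
    obtain ⟨x, hx⟩ := hK n 2 le_rfl (fun m => if m = 0 then w else y (n + 1))
      (fun m => if m = 0 then 0 else a (n + 1))
      (fun m => if m = 0 then a n + L n (a n) else a (n + 1) + L (n + 1) (a (n + 1)))
      (by simp)
      (by intro m _; by_cases h : m = 0 <;> simp [h])
      (by
        intro m hm
        obtain rfl : m = 0 := by omega
        have := hK0 n
        have := ha n
        simp only [if_true, zero_add, one_ne_zero, if_false]
        omega)
    refine ⟨x, fun i hi => ?_, fun i hi => ?_⟩
    · simpa using hx 0 (by omega) i (by simp) (by simpa using hi)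
    · simpa using hx 1 (by omega) (a (n + 1) + i) (by simp) (by simpa using hi)
  choose g hg₁ hg₂ using step
  let w : ℕ → X := fun n => Nat.rec (y 0) g n
  have hw : ∀ n, w (n + 1) = g n (w n) := fun _ => rfl
  have hmono : Monotone fun n => a n + L n (a n) :=
    monotone_nat_of_le_succ fun n => by have := ha n; omega
  have hclose : ∀ m i, i ≤ a m + L m (a m) →
      dist (f^[i] (w m)) (f^[i] (w (m + 1))) ≤ (1 / 2 : ℝ) ^ m := by
    intro m i hi
    rw [dist_comm, hw]
    exact (hg₁ m (w m) i hi).le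
  obtain ⟨x, hx⟩ := cauchySeq_tendsto_of_complete
    (cauchySeq_of_le_geometric (1 / 2 : ℝ) 1 (by norm_num)
      (fun n => by simpa using hclose n 0 (Nat.zero_le _)))
  have hlim : ∀ n i, i ≤ a n + L n (a n) →
      dist (f^[i] (w n)) (f^[i] x) ≤ 2 * (1 / 2 : ℝ) ^ n := by
    intro n i hi
    have ht : Tendsto (fun m => f^[i] (w (m + n))) atTop (𝓝 (f^[i] x)) :=
      (((hf.iterate i).tendsto x).comp hx).comp (tendsto_add_atTop_nat n)
    have := dist_le_of_le_geometric_of_tendsto₀ (1 / 2 : ℝ) ((1 / 2 : ℝ) ^ n) (by norm_num)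
      (fun m => by
        have := hclose (m + n) i (hi.trans (hmono (Nat.le_add_left n m)))
        rw [pow_add, mul_comm] at this
        rwa [Nat.add_right_comm] at this) ht
    rw [zero_add] at this
    calc _ ≤ _ := this
      _ = _ := by ring
  refine ⟨x, fun n i hi => ?_⟩
  have h1 := hlim n (a n + i) (by omega)
  cases n with
  | zero =>
    have h0 : a 0 + i = i := Nat.zero_add i
    rw [h0] at h1 ⊢
    rw [dist_comm]
    exact h1.trans (by norm_num)
  | succ n =>
    have h2 := (hg₂ n (w n) i hi).le
    rw [← hw] at h2
    have h3 := dist_triangle_left (f^[a (n + 1) + i] x) (f^[i] (y (n + 1)))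
      (f^[a (n + 1) + i] (w (n + 1)))
    rw [pow_succ] at *
    linarith

end Tracing

/-! ### Frequencies at the end of a long block -/

section Frequency

variable {X : Type*} [MetricSpace X] {f : X → X} {x y : X} {t : ℝ}

theorem closeFrequency_nonneg (n : ℕ) : 0 ≤ closeFrequency f x y t n := by
  unfold closeFrequency; positivity

theorem closeFrequency_le_one (n : ℕ) : closeFrequency f x y t n ≤ 1 := by
  unfold closeFrequency
  refine div_le_one_of_le₀ ?_ (by positivity)
  exact_mod_cast (Finset.card_filter_le _ _).trans_eq (Finset.card_range n)

/-- At worst every time before the block is bad. -/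
theorem one_sub_le_closeFrequency {a l : ℕ} (hl : 0 < l)
    (h : ∀ i < l, dist (f^[a + i] x) (f^[a + i] y) < t) :
    1 - (a : ℝ) / (a + l : ℕ) ≤ closeFrequency f x y t (a + l) := by
  have hpos : (0 : ℝ) < (a + l : ℕ) := by exact_mod_cast (by omega : 0 < a + l)
  unfold closeFrequency
  rw [one_sub_div hpos.ne']
  have hsub : Finset.Ico a (a + l) ⊆
      (Finset.range (a + l)).filter fun i => dist (f^[i] x) (f^[i] y) < t := by
    intro i hi
    obtain ⟨h1, h2⟩ := Finset.mem_Ico.1 hi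
    obtain ⟨j, rfl⟩ := Nat.exists_eq_add_of_le h1
    exact Finset.mem_filter.2 ⟨Finset.mem_range.2 h2, h j (by omega)⟩
  have hcard := Finset.card_le_card hsub
  rw [Nat.card_Ico, Nat.add_sub_cancel_left] at hcard
  gcongr
  push_cast
  rw [add_sub_cancel_left]
  exact_mod_cast hcard

theorem closeFrequency_le {a l : ℕ}
    (h : ∀ i < l, t ≤ dist (f^[a + i] x) (f^[a + i] y)) :
    closeFrequency f x y t (a + l) ≤ (a : ℝ) / (a + l : ℕ) := by
  unfold closeFrequency
  gcongr
  refine (Finset.card_le_card fun i hi => ?_).trans_eq (Finset.card_range a)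
  obtain ⟨h1, h2⟩ := Finset.mem_filter.1 hi
  rw [Finset.mem_range] at h1 ⊢
  by_contra! hai
  obtain ⟨j, rfl⟩ := Nat.exists_eq_add_of_le hai
  exact (h j (by omega)).not_gt h2

theorem limsup_closeFrequency_eq_one
    (h : ∀ c < 1, ∃ᶠ n in atTop, c ≤ closeFrequency f x y t n) :
    limsup (fun n => closeFrequency f x y t n) atTop = 1 := by
  have hb : IsBoundedUnder (· ≤ ·) atTop fun n => closeFrequency f x y t n :=
    isBoundedUnder_of ⟨1, closeFrequency_le_one⟩
  have hb' : IsBoundedUnder (· ≥ ·) atTop fun n => closeFrequency f x y t n :=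
    isBoundedUnder_of ⟨0, closeFrequency_nonneg⟩
  refine le_antisymm ?_ (le_of_forall_lt_imp_le_of_dense fun c hc => ?_)
  · exact limsup_le_of_le hb'.isCoboundedUnder_le (Eventually.of_forall closeFrequency_le_one)
  · exact le_limsup_of_frequently_le (h c hc) hb

theorem liminf_closeFrequency_eq_zero
    (h : ∀ c > 0, ∃ᶠ n in atTop, closeFrequency f x y t n ≤ c) :
    liminf (fun n => closeFrequency f x y t n) atTop = 0 := by
  have hb : IsBoundedUnder (· ≤ ·) atTop fun n => closeFrequency f x y t n :=
    isBoundedUnder_of ⟨1, closeFrequency_le_one⟩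
  have hb' : IsBoundedUnder (· ≥ ·) atTop fun n => closeFrequency f x y t n :=
    isBoundedUnder_of ⟨0, closeFrequency_nonneg⟩
  refine le_antisymm (le_of_forall_gt_imp_ge_of_dense fun c hc => ?_) ?_
  · exact liminf_le_of_frequently_le (h c hc) hb'
  · exact le_liminf_of_le hb.isCoboundedUnder_ge (Eventually.of_forall closeFrequency_nonneg)

theorem not_isDC1Pair_self (x : X) : ¬ IsDC1Pair f x x := by
  rintro ⟨-, t, ht, h⟩
  have : (fun n => closeFrequency f x x t n) =ᶠ[atTop] fun _ => (1 : ℝ) := by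
    filter_upwards [eventually_gt_atTop 0] with n hn
    have hn' : (n : ℝ) ≠ 0 := by exact_mod_cast hn.ne'
    simp [closeFrequency, ht, hn']
  rw [liminf_congr this, liminf_const] at h
  exact one_ne_zero h

end Frequency

/-! ### Birkhoff averages at the end of a long block -/

section Birkhoff

variable {X : Type*} {f : X → X} {φ : X → ℝ} {M : ℝ}

theorem abs_birkhoffSum_le (hM : ∀ x, |φ x| ≤ M) (n : ℕ) (x : X) :
    |birkhoffSum f φ n x| ≤ n * M := by
  unfold birkhoffSum
  refine (Finset.abs_sum_le_sum_abs _ _).trans ?_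
  simpa using Finset.sum_le_card_nsmul (Finset.range n) (fun i => |φ (f^[i] x)|) M
    fun i _ => hM _

theorem abs_birkhoffAverage_le (hM : ∀ x, |φ x| ≤ M) (hM0 : 0 ≤ M) (n : ℕ) (x : X) :
    |birkhoffAverage ℝ f φ n x| ≤ M := by
  unfold birkhoffAverage
  rw [smul_eq_mul, abs_mul, abs_inv, Nat.abs_cast, inv_mul_eq_div]
  exact div_le_of_le_mul₀ (by positivity) hM0
    ((abs_birkhoffSum_le hM n x).trans_eq (mul_comm _ _))

/-- If the orbit of `x` follows that of `z` up to an error `η` in `φ` after time `a`, then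
their Birkhoff averages are comparable. -/
theorem abs_birkhoffAverage_sub_le (hM : ∀ x, |φ x| ≤ M) {x z : X} {a l : ℕ} (hl : 0 < l)
    {η : ℝ} (h : ∀ i < l, |φ (f^[a + i] x) - φ (f^[i] z)| ≤ η) :
    |birkhoffAverage ℝ f φ (a + l) x - birkhoffAverage ℝ f φ l z| ≤
      2 * M * ((a : ℝ) / (a + l : ℕ)) + η := by
  have hl' : (0 : ℝ) < l := by exact_mod_cast hl
  have hN : (0 : ℝ) < (a + l : ℕ) := by exact_mod_cast (by omega : 0 < a + l)
  have hη : 0 ≤ η := (abs_nonneg _).trans (h 0 hl)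
  have hd : |birkhoffSum f φ l (f^[a] x) - birkhoffSum f φ l z| ≤ l * η := by
    unfold birkhoffSum
    rw [← Finset.sum_sub_distrib]
    refine (Finset.abs_sum_le_sum_abs _ _).trans ?_
    have := Finset.sum_le_card_nsmul (Finset.range l)
      (fun i => |φ (f^[i] (f^[a] x)) - φ (f^[i] z)|) η fun i hi => by
        rw [← Function.iterate_add_apply, add_comm]
        exact h i (Finset.mem_range.1 hi)
    simpa using this
  have hA := abs_birkhoffSum_le (f := f) hM a x
  have hB := abs_birkhoffSum_le (f := f) hM l z
  -- The prefix and the change of denominator from `l` to `a + l` each cost at most `a * M`.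
  have hid : birkhoffAverage ℝ f φ (a + l) x - birkhoffAverage ℝ f φ l z =
      (birkhoffSum f φ a x + (birkhoffSum f φ l (f^[a] x) - birkhoffSum f φ l z)
        - a * (birkhoffSum f φ l z / l)) / (a + l : ℕ) := by
    unfold birkhoffAverage
    rw [birkhoffSum_add, smul_eq_mul, smul_eq_mul]
    field_simp
    push_cast
    ring
  have hC : |(a : ℝ) * (birkhoffSum f φ l z / l)| ≤ a * M := by
    rw [abs_mul, Nat.abs_cast, abs_div, Nat.abs_cast]
    gcongr
    rw [div_le_iff₀ hl']
    linarith
  rw [hid, abs_div, abs_of_pos hN, div_le_iff₀ hN]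
  have hR : (2 * M * ((a : ℝ) / (a + l : ℕ)) + η) * (a + l : ℕ) =
      2 * M * a + η * (a + l : ℕ) := by
    field_simp
  rw [hR]
  have hle : (l : ℝ) * η ≤ η * (a + l : ℕ) := by
    push_cast
    nlinarith [mul_nonneg (Nat.cast_nonneg (α := ℝ) a) hη]
  refine (abs_sub _ _).trans ?_
  have := abs_add_le (birkhoffSum f φ a x) (birkhoffSum f φ l (f^[a] x) - birkhoffSum f φ l z)
  linarith

/-- The Birkhoff averages of an irregular point oscillate between two levels. -/
theorem exists_oscillation (hM : ∀ x, |φ x| ≤ M) (hM0 : 0 ≤ M) {z : X}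
    (hz : z ∈ irregularSet f φ) :
    ∃ α β : ℝ, α < β ∧ (∃ᶠ n in atTop, birkhoffAverage ℝ f φ n z < α) ∧
      ∃ᶠ n in atTop, β < birkhoffAverage ℝ f φ n z := by
  by_contra hcon
  push Not at hcon
  refine hz (tendsto_of_no_upcrossings dense_univ ?_ ?_ ?_)
  · rintro α - β - hlt ⟨h1, h2⟩
    exact h2 (by simpa [Filter.Frequently] using hcon α β hlt h1)
  · exact isBoundedUnder_of ⟨M, fun n => (abs_le.1 (abs_birkhoffAverage_le hM hM0 n z)).2⟩
  · exact isBoundedUnder_of ⟨-M, fun n => (abs_le.1 (abs_birkhoffAverage_le hM hM0 n z)).1⟩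

end Birkhoff

/-! ### The scrambled family -/

theorem theoremA {X : Type*} [MetricSpace X] [CompactSpace X] [Nontrivial X]
    (f : X → X) (hf : Continuous f) (hspec : HasSpecification f)
    (φ : X → ℝ) (hφ : Continuous φ) (hne : (irregularSet f φ).Nonempty) :
    ∃ S : Set X, S ⊆ irregularSet f φ ∧ ¬ S.Countable ∧ IsDC1ScrambledSet f S := by
  obtain ⟨z, hz⟩ := hne
  obtain ⟨M, hM⟩ : ∃ M, ∀ x, |φ x| ≤ M := by
    obtain ⟨M, hM⟩ := isCompact_univ.exists_bound_of_continuousOn hφ.continuousOn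
    exact ⟨M, fun x => hM x (Set.mem_univ x)⟩
  have hM0 : 0 ≤ M := (abs_nonneg _).trans (hM z)
  obtain ⟨α, β, hαβ, hα, hβ⟩ := exists_oscillation hM hM0 hz
  obtain ⟨u, v, c, hc, huv⟩ := exists_distal_pair hf hspec
  -- With `m = a n`, the term `n * m` makes the prefix a proportion at most `1 / (n + 1)`; the term
  -- `n` sends block ends to infinity.
  have hL : ∀ n m : ℕ, ∃ l : ℕ, n * m + n + 1 ≤ l ∧
      (n % 3 = 0 → birkhoffAverage ℝ f φ l z < α) ∧
      (n % 3 = 1 → β < birkhoffAverage ℝ f φ l z) := by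
    intro n m
    obtain ⟨l₁, h₁, h₁'⟩ := frequently_atTop.1 hα (n * m + n + 1)
    obtain ⟨l₂, h₂, h₂'⟩ := frequently_atTop.1 hβ (n * m + n + 1)
    by_cases h : n % 3 = 0
    · exact ⟨l₁, h₁, fun _ => h₁', fun h' => by omega⟩
    · exact ⟨l₂, h₂, fun h' => absurd h' h, fun _ => h₂'⟩
  choose L hLn hLα hLβ using hL
  obtain ⟨a, ha⟩ := exists_tracing_times hf hspec L
  -- `a n` and `l n` are the starting time and the length of the `n`-th block.
  set l : ℕ → ℕ := fun n => L n (a n) with hl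
  have hl0 : ∀ n, 0 < l n := fun n => by have := hLn n (a n); simp only [hl]; omega
  have hln : ∀ n, n ≤ a n + l n := fun n => by have := hLn n (a n); simp only [hl]; nlinarith
  have hN : Tendsto (fun n => a n + l n) atTop atTop := tendsto_atTop_mono hln tendsto_id
  have hratio : Tendsto (fun n => (a n : ℝ) / (a n + l n : ℕ)) atTop (𝓝 0) := by
    refine squeeze_zero (fun n => by positivity) (fun n => ?_)
      tendsto_one_div_add_atTop_nhds_zero_nat
    have h1 : (n * a n : ℝ) + n + 1 ≤ l n := by exact_mod_cast hLn n (a n)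
    have h2 : (0 : ℝ) < (a n + l n : ℕ) := by exact_mod_cast Nat.add_pos_right _ (hl0 n)
    rw [div_le_div_iff₀ h2 (by positivity)]
    push_cast
    nlinarith [Nat.cast_nonneg (α := ℝ) n]
  have herr : Tendsto (fun n : ℕ => 4 * (1 / 2 : ℝ) ^ n) atTop (𝓝 0) := by
    simpa using (tendsto_pow_atTop_nhds_zero_of_lt_one (r := (1 / 2 : ℝ)) (by norm_num)
      (by norm_num)).const_mul 4
  -- The block `3 k + 2` carries the bit of index `(unpair k).1`.
  choose x hx using fun ξ : ℕ → Bool => ha fun n =>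
    if n % 3 = 2 then (if ξ (Nat.unpair (n / 3)).1 then u else v) else z
  have hxz : ∀ ξ n, n % 3 ≠ 2 → ∀ i ≤ l n,
      dist (f^[a n + i] (x ξ)) (f^[i] z) ≤ 4 * (1 / 2 : ℝ) ^ n := by
    intro ξ n hn i hi
    simpa only [if_neg hn] using hx ξ n i hi
  have hirr : ∀ ξ, x ξ ∈ irregularSet f φ := by
    rintro ξ ⟨r, hr⟩
    have hclose : ∀ e > 0, ∀ᶠ n in atTop, n % 3 ≠ 2 →
        |birkhoffAverage ℝ f φ (a n + l n) (x ξ) - birkhoffAverage ℝ f φ (l n) z| ≤ e := by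
      intro e he
      obtain ⟨δ, hδ, huc⟩ := Metric.uniformContinuous_iff.1
        (CompactSpace.uniformContinuous_of_continuous hφ) (e / 2) (half_pos he)
      have h1 : ∀ᶠ n in atTop, 2 * M * ((a n : ℝ) / (a n + l n : ℕ)) < e / 2 :=
        (by simpa using hratio.const_mul (2 * M) :
          Tendsto (fun n => 2 * M * ((a n : ℝ) / (a n + l n : ℕ))) atTop (𝓝 0)).eventually_lt_const
          (half_pos he)
      filter_upwards [h1, herr.eventually_lt_const hδ] with n hn hn' hmod
      have := abs_birkhoffAverage_sub_le (f := f) hM (x := x ξ) (z := z) (a := a n) (hl0 n)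
        (η := e / 2) fun i hi => (huc ((hxz ξ n hmod i hi.le).trans_lt hn')).le
      linarith
    have hrN := hr.comp hN
    -- Two errors of a quarter on each side would give `r < α + (β - α) / 2` and `r > β - (β - α) /
    -- 2`.
    have he : 0 < (β - α) / 4 := by linarith
    have hnear : ∀ᶠ n in atTop,
        |birkhoffAverage ℝ f φ (a n + l n) (x ξ) - r| < (β - α) / 4 :=
      Metric.tendsto_nhds.1 hrN _ he
    obtain ⟨n, hn⟩ := eventually_atTop.1 ((hclose _ he).and hnear)
    have h0 := hn (3 * n) (by omega)
    have h1 := hn (3 * n + 1) (by omega)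
    have hlow := hLα (3 * n) (a (3 * n)) (by omega)
    have hhigh := hLβ (3 * n + 1) (a (3 * n + 1)) (by omega)
    have h0' := abs_le.1 (h0.1 (by omega))
    have h1' := abs_le.1 (h1.1 (by omega))
    have h0'' := abs_lt.1 h0.2
    have h1'' := abs_lt.1 h1.2
    simp only [hl] at *
    linarith [h0'.1, h0'.2, h1'.1, h1'.2, h0''.1, h0''.2, h1''.1, h1''.2]
  have hpair : ∀ ξ η, ξ ≠ η → IsDC1Pair f (x ξ) (x η) := by
    intro ξ η hne
    refine ⟨fun t ht => limsup_closeFrequency_eq_one fun b hb => ?_, c / 2, half_pos hc,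
      liminf_closeFrequency_eq_zero fun b hb => ?_⟩
    · have hev : ∀ᶠ n in atTop, n % 3 = 0 →
          b ≤ closeFrequency f (x ξ) (x η) t (a n + l n) := by
        filter_upwards [hratio.eventually_lt_const (sub_pos.2 hb),
          herr.eventually_lt_const (half_pos ht)] with n h1 h2 hmod
        have := one_sub_le_closeFrequency (f := f) (x := x ξ) (y := x η) (t := t) (a := a n)
          (hl0 n) fun i hi => by
            have h3 := hxz ξ n (by omega) i hi.le
            have h4 := hxz η n (by omega) i hi.le
            have h5 := dist_triangle_right (f^[a n + i] (x ξ)) (f^[a n + i] (x η)) (f^[i] z)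
            linarith
        linarith
      have hfr : ∃ᶠ n in atTop, n % 3 = 0 :=
        frequently_atTop.2 fun n => ⟨3 * n, by omega, by omega⟩
      exact hN.frequently ((hfr.and_eventually hev).mono fun n h => h.2 h.1)
    · obtain ⟨j, hj⟩ := Function.ne_iff.1 hne
      have hev : ∀ᶠ n in atTop, (n % 3 = 2 ∧ (Nat.unpair (n / 3)).1 = j) →
          closeFrequency f (x ξ) (x η) (c / 2) (a n + l n) ≤ b := by
        -- Tracing errors below `c / 4` at both points leave `c / 2` of the separation.
        filter_upwards [hratio.eventually_lt_const hb,
          herr.eventually_lt_const (by linarith : 0 < c / 4)] with n h1 h2 hmod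
        refine (closeFrequency_le fun i hi => ?_).trans h1.le
        have h3 := hx ξ n i hi.le
        have h4 := hx η n i hi.le
        simp only [if_pos hmod.1, hmod.2] at h3 h4
        have h5 := huv i
        have h6 := huv i
        rw [dist_comm] at h6
        have key : ∀ p q : X, c ≤ dist p q →
            dist (f^[a n + i] (x ξ)) p ≤ 4 * (1 / 2 : ℝ) ^ n →
            dist (f^[a n + i] (x η)) q ≤ 4 * (1 / 2 : ℝ) ^ n →
            c / 2 ≤ dist (f^[a n + i] (x ξ)) (f^[a n + i] (x η)) := by
          intro p q hpq hp hq
          have h7 := dist_triangle4_right p q (f^[a n + i] (x ξ)) (f^[a n + i] (x η))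
          rw [dist_comm p (f^[a n + i] (x ξ)), dist_comm q (f^[a n + i] (x η))] at h7
          linarith
        cases hξ : ξ j <;> cases hη : η j <;> simp [hξ, hη] at hj h3 h4
        · exact key _ _ h6 (by simpa using h3) (by simpa using h4)
        · exact key _ _ h5 (by simpa using h3) (by simpa using h4)
      have hfr : ∃ᶠ n in atTop, n % 3 = 2 ∧ (Nat.unpair (n / 3)).1 = j := by
        refine frequently_atTop.2 fun n => ⟨3 * Nat.pair j n + 2, ?_, by omega, ?_⟩
        · have := Nat.right_le_pair j n
          omega
        · have : (3 * Nat.pair j n + 2) / 3 = Nat.pair j n := by omega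
          rw [this, Nat.unpair_pair]
      exact hN.frequently ((hfr.and_eventually hev).mono fun n h => h.2 h.1)
  have hinj : Function.Injective x := by
    intro ξ η h
    by_contra hne
    have := hpair ξ η hne
    rw [h] at this
    exact not_isDC1Pair_self _ this
  refine ⟨Set.range x, ?_, fun hcount => ?_, ?_⟩
  · rintro _ ⟨ξ, rfl⟩
    exact hirr ξ
  · have : Countable (ℕ → Bool) := by
      have := hcount.to_subtype
      exact (Set.rangeFactorization_injective.2 hinj).countable
    have hle := Cardinal.mk_le_aleph0_iff.2 this
    rw [Cardinal.mk_pi] at hle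
    simp only [Cardinal.mk_fintype, Fintype.card_bool, Nat.cast_ofNat, Cardinal.prod_const,
      Cardinal.lift_id, Cardinal.mk_nat] at hle
    exact hle.not_gt (Cardinal.cantor _)
  · rintro _ ⟨ξ, rfl⟩ _ ⟨η, rfl⟩ hne
    exact hpair ξ η fun h => hne (by rw [h])
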